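/- Let $N\ge 1$. A deck is a permutation $d$ of $[N]=\{0,\dots,N-1\}$, where $d(p)$ is the card at position $p$ and position $0$ is the top. One step of the inverse uniform riffle shuffle draws a bit vector $b\in\{0,1\}^N$ uniformly at random and replaces $d$ by the deck $d^b$ in which the cards $d(p)$ with $b(p)=0$, in their relative order, lie on top of the cards $d(p)$ with $b(p)=1$, in their relative order. Let $\mathbf{riffle}(d,N,K)$ be the distribution of the deck after $K\in\mathbb N$ independent steps from $d$, let $U_N$ be the uniform distribution on the permutations of $[N]$, and let $TV(\mu,\nu)=\frac12\sum_x|\mu(x)-\nu(x)|$. For two decks $d_1,d_2$ let $\pi=d_2^{-1}\circ d_1$, and consider the partitions of the set of positions $[N]$ into contiguous blocks each of which is mapped to itself by $\pi$; there is a finest one. Let $B_{d_1,d_2}(c)$ be its block containing $d_1^{-1}(c)$, and $$d_M(d_1,d_2)=\frac1{N^2}\sum_{c\in[N]}\bigl(|B_{d_1,d_2}(c)|-1\bigr).$$ Then: 1. For all $N\ge1$, all decks $d_1,d_2$ and all $K\in\mathbb N$, $TV(\mathbf{riffle}(d_1,N,K),\mathbf{riffle}(d_2,N,K))\le N^2(1/2)^K$.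 2. For all $N\ge1$ and all decks $d_1,d_2$, let $b_1$ be uniform on $\{0,1\}^N$ and let $b_2=b_1\circ d_1^{-1}\circ d_2$, so that every card gets the same bit in both decks. Then $(d_1^{b_1},d_2^{b_2})$ is a coupling of one step from $d_1$ and one step from $d_2$, and $\mathbb E\bigl[d_M(d_1^{b_1},d_2^{b_2})\bigr]\le\frac12\,d_M(d_1,d_2)$. 3. For all $N\ge1$, all decks $d$ and all $K\in\mathbb N$, $TV(\mathbf{riffle}(d,N,K),U_N)\le N^2(1/2)^K$. 4. There is a constant $C$ such that for all $N\ge1$, all integers $K\ge 3\log_2 N$ and all decks $d$, $TV(\mathbf{riffle}(d,N,K),U_N)\le C/N$. In particular, for $K=\lceil 3\log_2N\rceil$ the distance to uniform is $O(1/N)$, uniformly in the initial deck. -/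

import Mathlib

open scoped BigOperators

noncomputable section

namespace Riffle

/-- A deck of `N` cards: `d p` is the card at position `p` (position `0` is the top), and
`d.symm c` is the position of the card `c`. Cards are named by `0, …, N - 1`. -/
abbrev Deck (N : ℕ) : Type := Equiv.Perm (Fin N)

/-- One deterministic step of the inverse riffle shuffle: the card at position `p` carries the bit
`b p`; the cards with bit `0` (`false`) are put on top of the cards with bit `1` (`true`), and
cards with the same bit keep their relative order. `Tuple.sort b` is the permutation which sorts
the tuple `b` stably. See `ofFn_split` for the description by concatenation. -/
def split {N : ℕ} (b : Fin N → Bool) (d : Deck N) : Deck N :=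
  (Tuple.sort b).trans d

/-- Total variation distance of two distributions on a finite type. -/
def tvDist {α : Type*} [Fintype α] (μ ν : PMF α) : ℝ :=
  (1 / 2) * ∑ x, |(μ x).toReal - (ν x).toReal|

/-- One random step of the inverse uniform riffle shuffle: the `N` bits are sampled uniformly. -/
def riffleStep {N : ℕ} (d : Deck N) : PMF (Deck N) :=
  (PMF.uniformOfFintype (Fin N → Bool)).map (fun b => split b d)

/-- The distribution of the deck after `K` steps of the inverse uniform riffle shuffle. -/
def riffle {N : ℕ} (d : Deck N) : ℕ → PMF (Deck N)
  | 0 => PMF.pure d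
  | K + 1 => (riffle d K).bind riffleStep

/-- A block decomposition of a permutation `π` of the positions, given as an equivalence relation:
a partition of the positions in contiguous blocks, each of which is mapped to itself by `π`. -/
def IsBlockDecomposition {N : ℕ} (π : Equiv.Perm (Fin N)) (s : Setoid (Fin N)) : Prop :=
  (∀ p, s p (π p)) ∧ ∀ p, {q | s p q}.OrdConnected

/-- The minimal (finest) block decomposition of `π`. -/
def minBlockDecomposition {N : ℕ} (π : Equiv.Perm (Fin N)) : Setoid (Fin N) :=
  sInf {s | IsBlockDecomposition π s}

/-- The finest block decomposition is indeed the least block decomposition. -/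
theorem isLeast_minBlockDecomposition {N : ℕ} (π : Equiv.Perm (Fin N)) :
    IsLeast {s | IsBlockDecomposition π s} (minBlockDecomposition π) := by
  refine ⟨⟨fun p s hs => hs.1 p, fun p => ⟨?_⟩⟩, fun s hs => sInf_le hs⟩
  intro x hx y hy z hz s hs
  exact (hs.2 p).out (hx s hs) (hy s hs) hz

/-- The number of positions in the block of card `c`, in the minimal block decomposition of the
permutation of positions which takes the position of each card in `d₁` to its position in `d₂`. -/
def blockSize {N : ℕ} (d₁ d₂ : Deck N) (c : Fin N) : ℕ :=
  {q | minBlockDecomposition (d₁.trans d₂.symm) (d₁.symm c) q}.ncard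

/-- The block decomposition distance of two decks. -/
def blockDist {N : ℕ} (d₁ d₂ : Deck N) : ℝ :=
  (1 / (N : ℝ) ^ 2) * ∑ c, ((blockSize d₁ d₂ c : ℝ) - 1)

/-- One step of two coupled shuffles, in which every card `c` gets the same bit in both decks:
`b₁ (d₁.symm c) = b₂ (d₂.symm c)`, where `b₁` is uniform. -/
def coupledStep {N : ℕ} (d₁ d₂ : Deck N) : PMF (Deck N × Deck N) :=
  (PMF.uniformOfFintype (Fin N → Bool)).map
    (fun b => (split b d₁, split (fun q => b (d₁.symm (d₂ q))) d₂))

/-- `split b d`, read from top to bottom, is the concatenation of the subsequence of the cards of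
`d` at the positions with bit `0` and the subsequence of those at the positions with bit `1`. -/
theorem ofFn_split {N : ℕ} (b : Fin N → Bool) (d : Deck N) :
    List.ofFn (split b d) =
      ((List.finRange N).filter (fun p => !b p)).map d ++
        ((List.finRange N).filter (fun p => b p)).map d := by
  rw [← List.map_append]
  have key : List.ofFn (Tuple.sort b) =
      (List.finRange N).filter (fun p => !b p) ++ (List.finRange N).filter (fun p => b p) := by
    have hlt : ∀ {i j : Fin N}, i < j →
        toLex (b (Tuple.sort b i), Tuple.sort b i) < toLex (b (Tuple.sort b j), Tuple.sort b j) := by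
      intro i j hij
      have hm := Tuple.monotone_sort b hij.le
      rw [Prod.Lex.lt_iff]
      rcases hm.lt_or_eq with h | h
      · exact Or.inl h
      · refine Or.inr ⟨h, ?_⟩
        exact (Tuple.eq_sort_iff.1 rfl).2 i j hij h
    refine List.Perm.eq_of_pairwise
      (le := fun p q => toLex (b p, p) < toLex (b q, q)) ?_ ?_ ?_ ?_
    · intro x y _ _ h h'
      exact absurd h' (not_lt_of_gt h)
    · rw [List.pairwise_ofFn]
      intro i j hij
      exact hlt hij
    · rw [List.pairwise_append]
      refine ⟨?_, ?_, ?_⟩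
      · rw [List.pairwise_filter]
        refine (List.pairwise_lt_finRange N).imp ?_
        intro x y hxy hx hy
        rw [Prod.Lex.lt_iff]
        right
        simp at hx hy
        simp [hx, hy, hxy]
      · rw [List.pairwise_filter]
        refine (List.pairwise_lt_finRange N).imp ?_
        intro x y hxy hx hy
        rw [Prod.Lex.lt_iff]
        right
        simp [hx, hy, hxy]
      · intro x hx y hy
        simp at hx hy
        rw [Prod.Lex.lt_iff]
        left
        simp [hx, hy]
    · refine (List.perm_ext_iff_of_nodup ?_ ?_).2 ?_
      · exact List.nodup_ofFn.2 (Tuple.sort b).injective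
      · refine List.Nodup.append ((List.nodup_finRange N).filter _)
          ((List.nodup_finRange N).filter _) ?_
        intro x hx hy
        simp at hx hy
        simp [hx] at hy
      · intro x
        have h1 : x ∈ List.ofFn (Tuple.sort b) := by
          rw [List.mem_ofFn]
          exact (Tuple.sort b).surjective x
        simp only [h1, true_iff, List.mem_append, List.mem_filter, List.mem_finRange, true_and]
        cases b x <;> simp
  rw [← key, List.map_ofFn]
  rfl

end Riffle

end

/-!
Let `π = d₂⁻¹ ∘ d₁`. When every card gets the same bit in both decks, a step sorts the positions
lexicographically by (bit, block), in either deck. The classes "same bit and same block" therefore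
occupy the same contiguous positions in both new decks, so they form a block decomposition there,
and each new block lies within a bit class of an old one. Any position `q ≠ p` of the block of `p`
gets the same bit as `p` with probability `1 / 2`, so the mean of `|block of p| - 1` is at most
halved.

Different decks have a block with two elements, hence `N ^ 2 * blockDist ≥ 1` off the diagonal.
A coupling which contracts such a function bounds the total variation distance of the two chains,
and averaging over a stationary second deck gives the distance to uniform.
-/

namespace Riffle

section Mean

variable {α β ι : Type*} [Fintype α]

/-- The expectation of a real function under a distribution on a finite type, as a finite sum. -/
noncomputable def mean (μ : PMF α) (f : α → ℝ) : ℝ :=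
  ∑ x, (μ x).toReal * f x

theorem mean_mono (μ : PMF α) {f g : α → ℝ} (h : ∀ x, f x ≤ g x) : mean μ f ≤ mean μ g :=
  Finset.sum_le_sum fun x _ => mul_le_mul_of_nonneg_left (h x) ENNReal.toReal_nonneg

theorem sum_toReal_eq_one (μ : PMF α) : ∑ x, (μ x).toReal = 1 := by
  rw [← ENNReal.toReal_sum fun x _ => μ.apply_ne_top x, ← tsum_fintype (L := .unconditional α),
    μ.tsum_coe, ENNReal.toReal_one]

theorem mean_const (μ : PMF α) (c : ℝ) : mean μ (fun _ => c) = c := by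
  rw [mean, ← Finset.sum_mul, sum_toReal_eq_one, one_mul]

theorem mean_const_mul (μ : PMF α) (c : ℝ) (f : α → ℝ) :
    mean μ (fun x => c * f x) = c * mean μ f := by
  simp only [mean, Finset.mul_sum, mul_left_comm]

theorem mean_sub (μ : PMF α) (f g : α → ℝ) :
    mean μ (fun x => f x - g x) = mean μ f - mean μ g := by
  simp only [mean, mul_sub, Finset.sum_sub_distrib]

theorem mean_sum (μ : PMF α) (s : Finset ι) (f : ι → α → ℝ) :
    mean μ (fun x => ∑ i ∈ s, f i x) = ∑ i ∈ s, mean μ (f i) := by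
  simp only [mean, Finset.mul_sum]
  exact Finset.sum_comm

theorem abs_mean_le (μ : PMF α) (f : α → ℝ) : |mean μ f| ≤ mean μ fun x => |f x| :=
  (Finset.abs_sum_le_sum_abs _ _).trans_eq <| Finset.sum_congr rfl fun x _ => by
    rw [abs_mul, abs_of_nonneg ENNReal.toReal_nonneg]

theorem toReal_bind_apply (μ : PMF α) (κ : α → PMF β) (y : β) :
    (μ.bind κ y).toReal = mean μ fun x => (κ x y).toReal := by
  rw [PMF.bind_apply, tsum_fintype, ENNReal.toReal_sum]
  · simp only [ENNReal.toReal_mul, mean]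
  · exact fun x _ => ENNReal.mul_ne_top (μ.apply_ne_top x) ((κ x).apply_ne_top y)

theorem mean_pure (x : α) (f : α → ℝ) : mean (PMF.pure x) f = f x := by
  classical
  simp [mean, PMF.pure_apply, apply_ite ENNReal.toReal]

theorem mean_bind [Fintype β] (μ : PMF α) (κ : α → PMF β) (f : β → ℝ) :
    mean (μ.bind κ) f = mean μ fun x => mean (κ x) f := by
  simp only [mean, toReal_bind_apply, Finset.sum_mul, Finset.mul_sum, mul_assoc]
  exact Finset.sum_comm

theorem mean_map [Fintype β] (μ : PMF α) (g : α → β) (f : β → ℝ) :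
    mean (μ.map g) f = mean μ fun x => f (g x) := by
  simp only [← PMF.bind_pure_comp, mean_bind, Function.comp_apply, mean_pure]

end Mean

theorem map_uniformOfFintype_equiv {α β : Type*} [Fintype α] [Fintype β] [Nonempty α] [Nonempty β]
    (e : α ≃ β) : (PMF.uniformOfFintype α).map e = PMF.uniformOfFintype β := by
  classical
  ext y
  simp [PMF.map_apply, ← e.symm_apply_eq, Fintype.card_congr e]

section RandomBits

variable {ι : Type*} [Fintype ι] [DecidableEq ι]

theorem mean_ite_bits_eq {p q : ι} (hpq : p ≠ q) :
    mean (PMF.uniformOfFintype (ι → Bool)) (fun b => if b p = b q then 1 else 0) = 1 / 2 := by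
  let flip : Equiv.Perm (ι → Bool) :=
    Function.Involutive.toPerm (fun b => Function.update b p (!b p)) fun b => by simp
  have hflip := mean_map (PMF.uniformOfFintype (ι → Bool)) flip
    fun b => if b p = b q then 1 else 0
  have hcompl : ∀ b : ι → Bool,
      (if flip b p = flip b q then (1 : ℝ) else 0) = 1 - if b p = b q then 1 else 0 := fun b => by
    have hflip_p : flip b p = !b p := Function.update_self p _ b
    have hflip_q : flip b q = b q := Function.update_of_ne hpq.symm _ b
    rw [hflip_p, hflip_q]
    cases b p <;> cases b q <;> simp
  rw [map_uniformOfFintype_equiv] at hflip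
  simp only [hcompl, mean_sub, mean_const] at hflip
  linarith

theorem mean_ncard_bits_eq_sub_one {S : Set ι} {p : ι} (hp : p ∈ S) :
    mean (PMF.uniformOfFintype (ι → Bool)) (fun b => ({q ∈ S | b p = b q}.ncard : ℝ) - 1) =
      1 / 2 * ((S.ncard : ℝ) - 1) := by
  classical
  set others : Finset ι := S.toFinset.erase p
  have hcount : ∀ b : ι → Bool, ({q ∈ S | b p = b q}.ncard : ℝ) - 1 =
      ∑ q ∈ others, if b p = b q then 1 else 0 := fun b => by
    have hset : {q ∈ S | b p = b q} = ↑(insert p {q ∈ others | b p = b q}) := by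
      ext q
      by_cases hq : q = p <;> simp [hq, hp, others]
    rw [hset, Set.ncard_coe_finset, Finset.card_insert_of_notMem (by simp [others])]
    simp
  have hothers : (S.ncard : ℝ) - 1 = others.card := by
    rw [Set.ncard_eq_toFinset_card', ← Finset.card_erase_add_one (Set.mem_toFinset.2 hp)]
    simp [others]
  simp only [hcount]
  rw [mean_sum, Finset.sum_congr rfl fun q hq => mean_ite_bits_eq (Finset.ne_of_mem_erase hq).symm,
    Finset.sum_const, nsmul_eq_mul, hothers, mul_comm]

end RandomBits

section TotalVariation

variable {α β : Type*} [Fintype α]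

theorem tvDist_self (μ : PMF α) : tvDist μ μ = 0 := by simp [tvDist]

theorem tvDist_le_one (μ ν : PMF α) : tvDist μ ν ≤ 1 := by
  have habs : ∑ x, |(μ x).toReal - (ν x).toReal| ≤ ∑ x, ((μ x).toReal + (ν x).toReal) :=
    Finset.sum_le_sum fun x _ => (abs_sub _ _).trans_eq (by simp)
  rw [Finset.sum_add_distrib, sum_toReal_eq_one, sum_toReal_eq_one] at habs
  unfold tvDist
  linarith

theorem tvDist_bind_le [Fintype β] (μ : PMF β) (κ κ' : β → PMF α) :
    tvDist (μ.bind κ) (μ.bind κ') ≤ mean μ fun z => tvDist (κ z) (κ' z) := by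
  simp only [tvDist, toReal_bind_apply, ← mean_sub, mean_const_mul, mean_sum]
  gcongr
  exact abs_mean_le _ _

end TotalVariation

section Coupling

variable {α : Type*}

/-- A joint distribution `γ` couples `μ` and `ν` if these are its two marginals. -/
def IsCoupling {β : Type*} (γ : PMF (α × β)) (μ : PMF α) (ν : PMF β) : Prop :=
  γ.map Prod.fst = μ ∧ γ.map Prod.snd = ν

/-- The distribution of the Markov chain with transition kernel `κ`, started at `x`, after the
given number of steps. -/
noncomputable def chain (κ : α → PMF α) (x : α) : ℕ → PMF α
  | 0 => PMF.pure x
  | K + 1 => (chain κ x K).bind κ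

theorem chain_succ_eq_bind_chain (κ : α → PMF α) (x : α) (K : ℕ) :
    chain κ x (K + 1) = (κ x).bind fun y => chain κ y K := by
  induction K with
  | zero => simp [chain]
  | succ K ih =>
    rw [chain, ih, PMF.bind_bind]
    rfl

theorem bind_chain_of_stationary {κ : α → PMF α} {ν : PMF α} (hν : ν.bind κ = ν) (K : ℕ) :
    ν.bind (fun x => chain κ x K) = ν := by
  induction K with
  | zero => exact PMF.bind_pure ν
  | succ K ih => simp only [chain, ← PMF.bind_bind, ih, hν]

variable [Fintype α] {κ : α → PMF α}

theorem tvDist_chain_le_of_contracting_coupling {γ : α → α → PMF (α × α)} {ρ : α → α → ℝ} {r : ℝ}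
    (hγ : ∀ x y, IsCoupling (γ x y) (κ x) (κ y)) (hr : 0 ≤ r)
    (hcontract : ∀ x y, mean (γ x y) (fun z => ρ z.1 z.2) ≤ r * ρ x y)
    (hnonneg : ∀ x, 0 ≤ ρ x x) (hsep : ∀ x y, x ≠ y → 1 ≤ ρ x y) (K : ℕ) (x y : α) :
    tvDist (chain κ x K) (chain κ y K) ≤ r ^ K * ρ x y := by
  induction K generalizing x y with
  | zero =>
    rw [pow_zero, one_mul]
    rcases eq_or_ne x y with rfl | hxy
    · exact (tvDist_self _).trans_le (hnonneg x)
    · exact (tvDist_le_one _ _).trans (hsep x y hxy)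
  | succ K ih =>
    calc tvDist (chain κ x (K + 1)) (chain κ y (K + 1))
        = tvDist ((γ x y).bind fun z => chain κ z.1 K) ((γ x y).bind fun z => chain κ z.2 K) := by
          rw [chain_succ_eq_bind_chain, chain_succ_eq_bind_chain, ← (hγ x y).1, ← (hγ x y).2,
            PMF.bind_map, PMF.bind_map]
          rfl
      _ ≤ mean (γ x y) fun z => tvDist (chain κ z.1 K) (chain κ z.2 K) := tvDist_bind_le _ _ _
      _ ≤ mean (γ x y) fun z => r ^ K * ρ z.1 z.2 := mean_mono _ fun z => ih z.1 z.2
      _ = r ^ K * mean (γ x y) fun z => ρ z.1 z.2 := mean_const_mul _ _ _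
      _ ≤ r ^ K * (r * ρ x y) := by gcongr; exact hcontract x y
      _ = r ^ (K + 1) * ρ x y := by ring

theorem tvDist_chain_stationary_le {ν : PMF α} (hν : ν.bind κ = ν) {x : α} {K : ℕ} {C : ℝ}
    (hC : ∀ y, tvDist (chain κ x K) (chain κ y K) ≤ C) : tvDist (chain κ x K) ν ≤ C :=
  calc tvDist (chain κ x K) ν
      = tvDist (ν.bind fun _ => chain κ x K) (ν.bind fun y => chain κ y K) := by
        rw [PMF.bind_const, bind_chain_of_stationary hν]
    _ ≤ mean ν fun y => tvDist (chain κ x K) (chain κ y K) := tvDist_bind_le _ _ _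
    _ ≤ mean ν fun _ => C := mean_mono ν hC
    _ = C := mean_const ν C

end Coupling

section MonotoneTuples

theorem exists_monotone_ker_eq {α : Type*} [LinearOrder α] (s : Setoid α)
    (hs : ∀ p, {q | s p q}.OrdConnected) : ∃ f : α → α, Monotone f ∧ Setoid.ker f = s := by
  let f : α → α := fun p => (Quotient.mk s p).out
  have hf : ∀ p, s p (f p) := fun p => s.symm' (Quotient.mk_out p)
  have hker : ∀ p q, f p = f q ↔ s p q := fun p q => Quotient.out_inj.trans Quotient.eq
  refine ⟨f, fun p q hpq => ?_, Setoid.ext hker⟩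
  by_contra! hlt
  suffices s p q from hlt.ne' ((hker p q).2 this)
  rcases le_total q (f p) with hq | hq
  · exact (hs p).out (s.refl' p) (hf p) ⟨hpq, hq⟩
  · exact s.trans' (hf p) (s.symm' ((hs q).out (hf q) (s.refl' q) ⟨hlt.le, hq⟩))

theorem ordConnected_ker_of_monotone {α β : Type*} [Preorder α] [PartialOrder β] {f : α → β}
    (hf : Monotone f) (p : α) : {q | Setoid.ker f p q}.OrdConnected := by
  have hpre : {q | Setoid.ker f p q} = f ⁻¹' {f p} := by
    ext q
    exact eq_comm
  exact hpre ▸ Set.ordConnected_singleton.preimage_mono hf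

theorem eq_of_monotone_of_comp_perm_eq {n : ℕ} {α : Type*} [PartialOrder α] {f g : Fin n → α}
    (hf : Monotone f) (hg : Monotone g) {π : Equiv.Perm (Fin n)} (h : g ∘ π = f) : f = g :=
  h.symm.trans (Tuple.unique_monotone (τ := 1) (h ▸ hf) hg)

theorem monotone_toLex_sort {n : ℕ} {α β : Type*} [LinearOrder α] [Preorder β]
    (f : Fin n → α) {r : Fin n → β} (hr : Monotone r) :
    Monotone fun i => toLex (f (Tuple.sort f i), r (Tuple.sort f i)) := by
  obtain ⟨hsort, hstable⟩ := Tuple.eq_sort_iff.1 (rfl : Tuple.sort f = _)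
  refine monotone_iff_forall_lt.2 fun i j hij => Prod.Lex.toLex_le_toLex.2 ?_
  exact (hsort hij.le).lt_or_eq.imp_right fun h => ⟨h, hr (hstable i j hij h).le⟩

end MonotoneTuples

section Blocks

variable {N : ℕ}

theorem isBlockDecomposition_ker {α : Type*} [PartialOrder α] {f g : Fin N → α}
    (hf : Monotone f) (hg : Monotone g) {π : Equiv.Perm (Fin N)} (h : g ∘ π = f) :
    IsBlockDecomposition π (Setoid.ker f) := by
  refine ⟨fun p => ?_, ordConnected_ker_of_monotone hf⟩
  rw [Setoid.ker_def, ← congrFun h p, eq_of_monotone_of_comp_perm_eq hf hg h, Function.comp_apply]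

theorem IsBlockDecomposition.comap_sort {π : Equiv.Perm (Fin N)} {s : Setoid (Fin N)}
    (hs : IsBlockDecomposition π s) (b : Fin N → Bool) :
    IsBlockDecomposition (((Tuple.sort b).trans π).trans (Tuple.sort (b ∘ π.symm)).symm)
      ((s ⊓ Setoid.ker b).comap (Tuple.sort b)) := by
  obtain ⟨r, hr, rfl⟩ := exists_monotone_ker_eq s hs.2
  have hker : (Setoid.ker r ⊓ Setoid.ker b).comap (Tuple.sort b) =
      Setoid.ker fun i => toLex (b (Tuple.sort b i), r (Tuple.sort b i)) := by
    ext i j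
    simp [Setoid.comap_rel, Setoid.inf_def, Setoid.ker_def, and_comm]
  rw [hker]
  refine isBlockDecomposition_ker (monotone_toLex_sort b hr)
    (monotone_toLex_sort (b ∘ π.symm) hr) (funext fun i => ?_)
  have hri : r (π (Tuple.sort b i)) = r (Tuple.sort b i) := (hs.1 (Tuple.sort b i)).symm
  simp [hri]

/-- The block of the position `p` in the finest block decomposition of `π`. Its elements are
positions, not cards. -/
def block (π : Equiv.Perm (Fin N)) (p : Fin N) : Set (Fin N) :=
  {q | minBlockDecomposition π p q}

theorem self_mem_block (π : Equiv.Perm (Fin N)) (p : Fin N) : p ∈ block π p :=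
  (minBlockDecomposition π).refl' p

theorem apply_mem_block (π : Equiv.Perm (Fin N)) (p : Fin N) : π p ∈ block π p :=
  (isLeast_minBlockDecomposition π).1.1 p

theorem blockSize_apply (d₁ d₂ : Deck N) (p : Fin N) :
    blockSize d₁ d₂ (d₁ p) = (block (d₁.trans d₂.symm) p).ncard := by
  rw [blockSize, Equiv.symm_apply_apply, block]

theorem block_sort_subset_preimage_sort (π : Equiv.Perm (Fin N)) (b : Fin N → Bool) (i : Fin N) :
    block (((Tuple.sort b).trans π).trans (Tuple.sort (b ∘ π.symm)).symm) i ⊆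
      Tuple.sort b ⁻¹' {q ∈ block π (Tuple.sort b i) | b (Tuple.sort b i) = b q} := fun _ hq =>
  (isLeast_minBlockDecomposition _).2
    ((isLeast_minBlockDecomposition π).1.comap_sort b) hq

theorem blockSize_split_le (d₁ d₂ : Deck N) (b : Fin N → Bool) (p : Fin N) :
    blockSize (split b d₁) (split (fun q => b (d₁.symm (d₂ q))) d₂) (d₁ p) ≤
      {q ∈ block (d₁.trans d₂.symm) p | b p = b q}.ncard := by
  obtain ⟨i, rfl⟩ := (Tuple.sort b).surjective p
  change blockSize (split b d₁) _ (split b d₁ i) ≤ _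
  rw [blockSize_apply]
  refine (Set.ncard_le_ncard (block_sort_subset_preimage_sort (d₁.trans d₂.symm) b i)).trans_eq ?_
  exact Set.ncard_preimage_of_injective_subset_range (Tuple.sort b).injective
    (by simp [(Tuple.sort b).surjective.range_eq])

theorem one_le_blockSize (d₁ d₂ : Deck N) (c : Fin N) : 1 ≤ blockSize d₁ d₂ c :=
  (Set.ncard_pos (Set.toFinite _)).2 ⟨d₁.symm c, Setoid.refl' (minBlockDecomposition _) _⟩

theorem blockSize_le (d₁ d₂ : Deck N) (c : Fin N) : blockSize d₁ d₂ c ≤ N :=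
  (Set.ncard_le_card _).trans_eq (Nat.card_fin N)

theorem two_le_blockSize {d₁ d₂ : Deck N} {p : Fin N} (h : d₁ p ≠ d₂ p) :
    2 ≤ blockSize d₁ d₂ (d₁ p) := by
  have hmoved : p ≠ (d₁.trans d₂.symm) p := fun hp => h ((Equiv.eq_symm_apply _).1 hp).symm
  rw [blockSize_apply]
  exact (Set.one_lt_ncard (Set.toFinite _)).2
    ⟨p, self_mem_block _ p, _, apply_mem_block _ p, hmoved⟩

theorem blockSize_sub_one_nonneg (d₁ d₂ : Deck N) (c : Fin N) :
    0 ≤ (blockSize d₁ d₂ c : ℝ) - 1 :=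
  sub_nonneg.2 (Nat.one_le_cast.2 (one_le_blockSize d₁ d₂ c))

theorem sq_mul_blockDist (d₁ d₂ : Deck N) :
    (N : ℝ) ^ 2 * blockDist d₁ d₂ = ∑ c, ((blockSize d₁ d₂ c : ℝ) - 1) := by
  rcases N.eq_zero_or_pos with rfl | hN
  · simp
  · rw [blockDist, ← mul_assoc, mul_one_div_cancel (by positivity), one_mul]

theorem sq_mul_blockDist_nonneg (d₁ d₂ : Deck N) : 0 ≤ (N : ℝ) ^ 2 * blockDist d₁ d₂ := by
  rw [sq_mul_blockDist]
  exact Finset.sum_nonneg fun c _ => blockSize_sub_one_nonneg d₁ d₂ c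

theorem sq_mul_blockDist_le (d₁ d₂ : Deck N) : (N : ℝ) ^ 2 * blockDist d₁ d₂ ≤ (N : ℝ) ^ 2 :=
  calc (N : ℝ) ^ 2 * blockDist d₁ d₂
      = ∑ c, ((blockSize d₁ d₂ c : ℝ) - 1) := sq_mul_blockDist d₁ d₂
    _ ≤ ∑ _c : Fin N, (N : ℝ) := Finset.sum_le_sum fun c _ =>
        (sub_le_self _ zero_le_one).trans (Nat.cast_le.2 (blockSize_le d₁ d₂ c))
    _ = (N : ℝ) ^ 2 := by simp [sq]

theorem one_le_sq_mul_blockDist {d₁ d₂ : Deck N} (h : d₁ ≠ d₂) :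
    1 ≤ (N : ℝ) ^ 2 * blockDist d₁ d₂ := by
  obtain ⟨p, hp⟩ : ∃ p, d₁ p ≠ d₂ p := DFunLike.ne_iff.1 h
  have htwo : (2 : ℝ) ≤ blockSize d₁ d₂ (d₁ p) := by exact_mod_cast two_le_blockSize hp
  calc (1 : ℝ) ≤ (blockSize d₁ d₂ (d₁ p) : ℝ) - 1 := by linarith
    _ ≤ ∑ c, ((blockSize d₁ d₂ c : ℝ) - 1) := Finset.single_le_sum
        (f := fun c => (blockSize d₁ d₂ c : ℝ) - 1)
        (fun c _ => blockSize_sub_one_nonneg d₁ d₂ c) (Finset.mem_univ (d₁ p))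
    _ = (N : ℝ) ^ 2 * blockDist d₁ d₂ := (sq_mul_blockDist d₁ d₂).symm

end Blocks

section Shuffle

variable {N : ℕ}

theorem isCoupling_coupledStep (d₁ d₂ : Deck N) :
    IsCoupling (coupledStep d₁ d₂) (riffleStep d₁) (riffleStep d₂) := by
  refine ⟨by rw [coupledStep, PMF.map_comp]; rfl, ?_⟩
  rw [riffleStep, ← map_uniformOfFintype_equiv
    (Equiv.arrowCongr (d₁.trans d₂.symm) (Equiv.refl Bool)), PMF.map_comp, coupledStep,
    PMF.map_comp]
  rfl

theorem mean_coupledStep_blockDist_le (d₁ d₂ : Deck N) :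
    mean (coupledStep d₁ d₂) (fun x => blockDist x.1 x.2) ≤ 1 / 2 * blockDist d₁ d₂ := by
  let π := d₁.trans d₂.symm
  let bits := PMF.uniformOfFintype (Fin N → Bool)
  calc mean (coupledStep d₁ d₂) (fun x => blockDist x.1 x.2)
      = mean bits fun b => blockDist (split b d₁) (split (fun q => b (d₁.symm (d₂ q))) d₂) :=
        mean_map _ _ _
    _ ≤ mean bits fun b =>
          1 / (N : ℝ) ^ 2 * ∑ p, (({q ∈ block π p | b p = b q}.ncard : ℝ) - 1) := by
        refine mean_mono _ fun b => ?_
        rw [blockDist, ← Equiv.sum_comp d₁]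
        gcongr with p
        exact blockSize_split_le d₁ d₂ b p
    _ = 1 / (N : ℝ) ^ 2 * ∑ p, 1 / 2 * (((block π p).ncard : ℝ) - 1) := by
        rw [mean_const_mul, mean_sum]
        simp only [bits, mean_ncard_bits_eq_sub_one (self_mem_block π _)]
    _ = 1 / 2 * blockDist d₁ d₂ := by
        rw [blockDist, ← Equiv.sum_comp d₁ fun c => (blockSize d₁ d₂ c : ℝ) - 1, ← Finset.mul_sum,
          mul_left_comm]
        simp only [blockSize_apply, π]

theorem riffle_eq_chain (d : Deck N) (K : ℕ) : riffle d K = chain riffleStep d K := by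
  induction K with
  | zero => rfl
  | succ K ih => rw [riffle, ih, chain]

theorem tvDist_riffle_le (d₁ d₂ : Deck N) (K : ℕ) :
    tvDist (riffle d₁ K) (riffle d₂ K) ≤ (N : ℝ) ^ 2 * (1 / 2 : ℝ) ^ K := by
  have hcontract : ∀ d₁ d₂ : Deck N,
      mean (coupledStep d₁ d₂) (fun x => (N : ℝ) ^ 2 * blockDist x.1 x.2) ≤
        1 / 2 * ((N : ℝ) ^ 2 * blockDist d₁ d₂) := fun d₁ d₂ => by
    rw [mean_const_mul, mul_left_comm]
    gcongr
    exact mean_coupledStep_blockDist_le d₁ d₂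
  calc tvDist (riffle d₁ K) (riffle d₂ K)
      = tvDist (chain riffleStep d₁ K) (chain riffleStep d₂ K) := by
        rw [riffle_eq_chain, riffle_eq_chain]
    _ ≤ (1 / 2) ^ K * ((N : ℝ) ^ 2 * blockDist d₁ d₂) :=
        tvDist_chain_le_of_contracting_coupling isCoupling_coupledStep (by norm_num) hcontract
          (fun d => sq_mul_blockDist_nonneg d d) (fun _ _ => one_le_sq_mul_blockDist) K d₁ d₂
    _ ≤ (1 / 2) ^ K * (N : ℝ) ^ 2 := by gcongr; exact sq_mul_blockDist_le d₁ d₂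
    _ = (N : ℝ) ^ 2 * (1 / 2) ^ K := mul_comm _ _

theorem uniform_bind_riffleStep :
    (PMF.uniformOfFintype (Deck N)).bind riffleStep = PMF.uniformOfFintype (Deck N) := by
  have hsplit : ∀ b : Fin N → Bool, (PMF.uniformOfFintype (Deck N)).bind
      (fun d => PMF.pure (split b d)) = PMF.uniformOfFintype (Deck N) := fun b =>
    (PMF.bind_pure_comp _ _).trans (map_uniformOfFintype_equiv (Equiv.mulRight (Tuple.sort b)))
  calc (PMF.uniformOfFintype (Deck N)).bind riffleStep
      = (PMF.uniformOfFintype (Deck N)).bind fun d =>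
          (PMF.uniformOfFintype (Fin N → Bool)).bind fun b => PMF.pure (split b d) := rfl
    _ = (PMF.uniformOfFintype (Fin N → Bool)).bind fun b =>
          (PMF.uniformOfFintype (Deck N)).bind fun d => PMF.pure (split b d) :=
        PMF.bind_comm _ _ _
    _ = PMF.uniformOfFintype (Deck N) := by simp only [hsplit, PMF.bind_const]

theorem tvDist_riffle_uniform_le (d : Deck N) (K : ℕ) :
    tvDist (riffle d K) (PMF.uniformOfFintype (Deck N)) ≤ (N : ℝ) ^ 2 * (1 / 2 : ℝ) ^ K := by
  rw [riffle_eq_chain]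
  refine tvDist_chain_stationary_le uniform_bind_riffleStep fun d' => ?_
  rw [← riffle_eq_chain, ← riffle_eq_chain]
  exact tvDist_riffle_le d d' K

end Shuffle

theorem half_pow_le_inv_pow_of_mul_logb_le {x : ℝ} (hx : 0 < x) {m K : ℕ}
    (h : m * Real.logb 2 x ≤ K) : (1 / 2 : ℝ) ^ K ≤ (x ^ m)⁻¹ := by
  rw [← Real.logb_pow, Real.logb_le_iff_le_rpow one_lt_two (by positivity),
    Real.rpow_natCast] at h
  rw [one_div, inv_pow]
  gcongr

theorem tvDist_riffle_uniform_le_inv {N : ℕ} (hN : 0 < N) {K : ℕ} (hK : 3 * Real.logb 2 N ≤ K)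
    (d : Deck N) : tvDist (riffle d K) (PMF.uniformOfFintype (Deck N)) ≤ 1 / N :=
  have hNpos : (0 : ℝ) < N := Nat.cast_pos.2 hN
  calc tvDist (riffle d K) (PMF.uniformOfFintype (Deck N))
      ≤ (N : ℝ) ^ 2 * (1 / 2) ^ K := tvDist_riffle_uniform_le d K
    _ ≤ (N : ℝ) ^ 2 * ((N : ℝ) ^ 3)⁻¹ := by
        gcongr
        exact half_pow_le_inv_pow_of_mul_logb_le hNpos (m := 3) (by exact_mod_cast hK)
    _ = 1 / N := by field_simp

end Riffle

theorem mainTheorem10 :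
    -- any two decks
    (∀ N : ℕ, 0 < N → ∀ (d₁ d₂ : Riffle.Deck N) (K : ℕ),
      Riffle.tvDist (Riffle.riffle d₁ K) (Riffle.riffle d₂ K) ≤ (N : ℝ) ^ 2 * (1 / 2 : ℝ) ^ K) ∧
    -- one step of the coupled shuffles halves the block decomposition distance in expectation
    (∀ N : ℕ, 0 < N → ∀ d₁ d₂ : Riffle.Deck N,
      (Riffle.coupledStep d₁ d₂).map Prod.fst = Riffle.riffleStep d₁ ∧
      (Riffle.coupledStep d₁ d₂).map Prod.snd = Riffle.riffleStep d₂ ∧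
      ∑ x, ((Riffle.coupledStep d₁ d₂) x).toReal * Riffle.blockDist x.1 x.2
        ≤ (1 / 2) * Riffle.blockDist d₁ d₂) ∧
    -- exponential convergence to the uniform distribution
    (∀ N : ℕ, 0 < N → ∀ (d : Riffle.Deck N) (K : ℕ),
      Riffle.tvDist (Riffle.riffle d K) (PMF.uniformOfFintype (Riffle.Deck N))
        ≤ (N : ℝ) ^ 2 * (1 / 2 : ℝ) ^ K) ∧
    -- the distance to uniform is `O(1/N)`, uniformly in the initial deck
    (∃ C : ℝ, ∀ N : ℕ, 0 < N → ∀ K : ℕ, 3 * Real.logb 2 N ≤ K → ∀ d : Riffle.Deck N,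
      Riffle.tvDist (Riffle.riffle d K) (PMF.uniformOfFintype (Riffle.Deck N)) ≤ C / N) := by
  refine ⟨fun _ _ => Riffle.tvDist_riffle_le,
    fun _ _ d₁ d₂ =>
      have ⟨hfst, hsnd⟩ := Riffle.isCoupling_coupledStep d₁ d₂
      ⟨hfst, hsnd, Riffle.mean_coupledStep_blockDist_le d₁ d₂⟩,
    fun _ _ => Riffle.tvDist_riffle_uniform_le,
    1, fun _ hN _ => Riffle.tvDist_riffle_uniform_le_inv hN⟩
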